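/- All trees are finite. A \emph{subtree} of a tree $T$ is a nonempty subgraph of $T$ that is itself a tree. For a vertex $v$ of $T$, let $p(T,v)=N(T,v)/N(T)$, where $N(T)$ is the number of subtrees of $T$ and $N(T,v)$ is the number of subtrees of $T$ that contain $v$; that is, $p(T,v)$ is the probability that a uniformly random subtree of $T$ contains $v$. A tree is \emph{series-reduced} if it has no vertex of degree $2$, and a \emph{leaf} is a vertex of degree $1$. 1. As $T$ ranges over all trees and $v$ over all vertices of $T$, the values $p(T,v)$ are dense in $[0,1]$. 2. Let $T$ be a series-reduced tree with more than $2$ vertices and let $v$ be a vertex of $T$. If $v$ is a leaf, then $p(T,v)\in[\frac13,\frac12]$; otherwise $p(T,v)\in[\frac23,1]$. 3. As $T$ ranges over all series-reduced trees with more than $2$ vertices, the values $p(T,v)$ for leaves $v$ of $T$ are dense in $[\frac13,\frac12]$, and the values $p(T,v)$ for vertices $v$ of $T$ that are not leaves are dense in $[\frac23,1]$. -/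

import Mathlib

/-- The set of subtrees of `T`: the subgraphs of `T` that are themselves trees
(trees are nonempty, since connected graphs are nonempty in Mathlib). -/
def subtrees {V : Type*} (T : SimpleGraph V) : Set T.Subgraph :=
  {S | S.coe.IsTree}

/-- The set of subtrees of `T` that contain the vertex `v`. -/
def subtreesAt {V : Type*} (T : SimpleGraph V) (v : V) : Set T.Subgraph :=
  {S | S ∈ subtrees T ∧ v ∈ S.verts}

/-- The probability that a uniformly random subtree of the (finite) tree `T` contains `v`. -/
noncomputable def subtreeProb {V : Type*} (T : SimpleGraph V) (v : V) : ℝ :=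
  ((subtreesAt T v).ncard : ℝ) / ((subtrees T).ncard : ℝ)

/-- No vertex of `T` has degree 2. -/
def IsSeriesReduced {V : Type*} (T : SimpleGraph V) : Prop :=
  ∀ v, (T.neighborSet v).ncard ≠ 2

/-- The vertex `v` has degree 1. -/
def IsLeafOf {V : Type*} (T : SimpleGraph V) (v : V) : Prop :=
  (T.neighborSet v).ncard = 1

/-- All values of `subtreeProb T v` for a finite tree `T` and a vertex `v`. -/
def treeValues : Set ℝ :=
  {p | ∃ (V : Type) (_ : Finite V) (T : SimpleGraph V) (v : V),
    T.IsTree ∧ p = subtreeProb T v}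

/-- All values of `subtreeProb T v` for a finite series-reduced tree `T` with more than two
vertices and a leaf `v` of `T`. -/
def leafValues : Set ℝ :=
  {p | ∃ (V : Type) (_ : Finite V) (T : SimpleGraph V) (v : V),
    T.IsTree ∧ IsSeriesReduced T ∧ 2 < Nat.card V ∧ IsLeafOf T v ∧ p = subtreeProb T v}

/-- All values of `subtreeProb T v` for a finite series-reduced tree `T` with more than two
vertices and a vertex `v` of `T` that is not a leaf. -/
def internalValues : Set ℝ :=
  {p | ∃ (V : Type) (_ : Finite V) (T : SimpleGraph V) (v : V),
    T.IsTree ∧ IsSeriesReduced T ∧ 2 < Nat.card V ∧ ¬ IsLeafOf T v ∧ p = subtreeProb T v}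

/-
Let `x` be the odds that a random subtree avoids the vertex `v`, so that `p(T, v) = 1 / (1 + x)`.
Joining `v` to a new root that also carries `k` leaves changes the odds from `x` to
`(1 + x) / 2 ^ k`, up to an error that vanishes as the number of subtrees through `v` grows. For
`k ≥ 1` these maps contract `[0, 1]` and their images cover `(0, 1]`, so the closed set of limiting
odds, which contains `0` because of stars, contains `[0, 1]`; here the root has degree at least 2.
One more step gives `[0, 1/2]` for roots of degree at least 3 (`k ≥ 2`), `[1, 2]` for leaves
(`k = 0`), and, by iterating `k = 0`, all of `[0, ∞)` for arbitrary trees. That series-reduced trees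
have no other odds is proved by cutting an edge at `v` and inducting on the two sides.
-/

open Filter Set SimpleGraph Topology

universe u

section Connectivity

variable {V W : Type*} {G : SimpleGraph V} {H : SimpleGraph W}

lemma reachable_of_forall_adj {f : V → W} (hf : ∀ a b, G.Adj a b → f a = f b ∨ H.Adj (f a) (f b))
    {a b : V} (hab : G.Reachable a b) : H.Reachable (f a) (f b) := by
  rw [reachable_iff_reflTransGen] at hab ⊢
  refine Relation.ReflTransGen.lift' f (fun a b hab ↦ ?_) a b hab
  rw [Function.onFun, ← reachable_iff_reflTransGen]
  obtain h | h := hf a b hab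
  exacts [h ▸ Reachable.rfl, h.reachable]

lemma connected_induce_image {f : V → W} {A : Set V}
    (hf : ∀ a ∈ A, ∀ b ∈ A, G.Adj a b → f a = f b ∨ H.Adj (f a) (f b))
    (hA : (G.induce A).Connected) : (H.induce (f '' A)).Connected := by
  have := hA.nonempty.map (imageFactorization f A)
  refine ⟨fun x y ↦ ?_⟩
  obtain ⟨a, rfl⟩ := imageFactorization_surjective x
  obtain ⟨b, rfl⟩ := imageFactorization_surjective y
  exact reachable_of_forall_adj (G := G.induce A)
    (fun a b hab ↦ (hf a a.2 b b.2 hab).imp Subtype.ext id) (hA.preconnected a b)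

lemma eq_of_connected_induce {f : V → W} {A : Set V}
    (hf : ∀ a ∈ A, ∀ b ∈ A, G.Adj a b → f a = f b) (hA : (G.induce A).Connected) {a b : V}
    (ha : a ∈ A) (hb : b ∈ A) : f a = f b :=
  reachable_bot.1 <| reachable_of_forall_adj (f := fun a : A ↦ f a)
    (fun a b hab ↦ .inl (hf a a.2 b b.2 hab)) (hA.preconnected ⟨a, ha⟩ ⟨b, hb⟩)

lemma connected_induce_preimage_iso (e : G ≃g H) {B : Set W} :
    (G.induce (e ⁻¹' B)).Connected ↔ (H.induce B).Connected := by
  constructor <;> intro h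
  · rw [← image_preimage_eq B e.surjective]
    exact connected_induce_image (fun _ _ _ _ hab ↦ .inr (e.map_adj_iff.2 hab)) h
  · have himage : e.symm '' B = e ⁻¹' B := e.toEquiv.image_symm_eq_preimage B
    rw [← himage]
    exact connected_induce_image (fun _ _ _ _ hab ↦ .inr (e.symm.map_adj_iff.2 hab)) h

lemma isAcyclic_sum (hG : G.IsAcyclic) (hH : H.IsAcyclic) : (G ⊕g H).IsAcyclic := by
  rw [isAcyclic_iff_forall_adj_isBridge] at hG hH ⊢
  rintro (a | a) (b | b) hab
  · refine fun h ↦ hG hab (reachable_of_forall_adj (f := Sum.elim id fun _ ↦ a) ?_ h)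
    rintro (x | x) (y | y) hxy <;> simp_all [deleteEdges_adj]
  · simp at hab
  · simp at hab
  · refine fun h ↦ hH hab (reachable_of_forall_adj (f := Sum.elim (fun _ ↦ a) id) ?_ h)
    rintro (x | x) (y | y) hxy <;> simp_all [deleteEdges_adj]

end Connectivity

/-- The disjoint union of `G` and `H` together with a new edge joining `r` to `s`. Grafting is the
operation that builds every finite tree out of single vertices. -/
def graft {V W : Type*} (G : SimpleGraph V) (r : V) (H : SimpleGraph W) (s : W) :
    SimpleGraph (V ⊕ W) :=
  (G ⊕g H) ⊔ edge (.inl r) (.inr s)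

section Graft

variable {V W : Type*} {G : SimpleGraph V} {r : V} {H : SimpleGraph W} {s : W}

@[simp] lemma graft_adj_inl_inl {a b : V} :
    (graft G r H s).Adj (.inl a) (.inl b) ↔ G.Adj a b := by
  simp [graft, edge_adj]

@[simp] lemma graft_adj_inr_inr {a b : W} :
    (graft G r H s).Adj (.inr a) (.inr b) ↔ H.Adj a b := by
  simp [graft, edge_adj]

@[simp] lemma graft_adj_inl_inr {a : V} {b : W} :
    (graft G r H s).Adj (.inl a) (.inr b) ↔ a = r ∧ b = s := by
  simp [graft, edge_adj]

@[simp] lemma graft_adj_inr_inl {a : V} {b : W} :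
    (graft G r H s).Adj (.inr b) (.inl a) ↔ a = r ∧ b = s := by
  rw [adj_comm, graft_adj_inl_inr]

lemma isTree_graft (hG : G.IsTree) (hH : H.IsTree) (r : V) (s : W) : (graft G r H s).IsTree :=
  ⟨hG.connected.sum_sup_edge hH.connected,
    (isAcyclic_sum hG.isAcyclic hH.isAcyclic).sup_edge_of_not_reachable
      (not_reachable_sum_inl_inr r s)⟩

lemma ncard_neighborSet_graft_inl_root [Finite V] :
    ((graft G r H s).neighborSet (.inl r)).ncard = (G.neighborSet r).ncard + 1 := by
  have : (graft G r H s).neighborSet (.inl r) = insert (.inr s) (.inl '' G.neighborSet r) := by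
    ext (x | x) <;> simp
  rw [this, ncard_insert_of_notMem (by simp), ncard_image_of_injective _ Sum.inl_injective]

lemma ncard_neighborSet_graft_inr_root [Finite W] :
    ((graft G r H s).neighborSet (.inr s)).ncard = (H.neighborSet s).ncard + 1 := by
  have : (graft G r H s).neighborSet (.inr s) = insert (.inl r) (.inr '' H.neighborSet s) := by
    ext (x | x) <;> simp
  rw [this, ncard_insert_of_notMem (by simp), ncard_image_of_injective _ Sum.inr_injective]

lemma ncard_neighborSet_graft_inl {a : V} (ha : a ≠ r) :
    ((graft G r H s).neighborSet (.inl a)).ncard = (G.neighborSet a).ncard := by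
  have : (graft G r H s).neighborSet (.inl a) = .inl '' G.neighborSet a := by
    ext (x | x) <;> simp [ha]
  rw [this, ncard_image_of_injective _ Sum.inl_injective]

lemma ncard_neighborSet_graft_inr {b : W} (hb : b ≠ s) :
    ((graft G r H s).neighborSet (.inr b)).ncard = (H.neighborSet b).ncard := by
  have : (graft G r H s).neighborSet (.inr b) = .inr '' H.neighborSet b := by
    ext (x | x) <;> simp [hb]
  rw [this, ncard_image_of_injective _ Sum.inr_injective]

lemma connected_induce_preimage_inl {C : Set (V ⊕ W)} (hC : ((graft G r H s).induce C).Connected)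
    (hr : (Sum.inr ⁻¹' C).Nonempty → .inl r ∈ C) : (G.induce (Sum.inl ⁻¹' C)).Connected := by
  have himage : Sum.elim id (fun _ ↦ r) '' C = Sum.inl ⁻¹' C := by
    ext a
    refine ⟨?_, fun ha ↦ ⟨.inl a, ha, rfl⟩⟩
    rintro ⟨x | y, hx, rfl⟩
    exacts [hx, hr ⟨y, hx⟩]
  rw [← himage]
  refine connected_induce_image ?_ hC
  rintro (a | a) - (b | b) - hab <;> simp_all

lemma connected_induce_preimage_inr {C : Set (V ⊕ W)} (hC : ((graft G r H s).induce C).Connected)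
    (hs : (Sum.inl ⁻¹' C).Nonempty → .inr s ∈ C) : (H.induce (Sum.inr ⁻¹' C)).Connected := by
  have himage : Sum.elim (fun _ ↦ s) id '' C = Sum.inr ⁻¹' C := by
    ext b
    refine ⟨?_, fun hb ↦ ⟨.inr b, hb, rfl⟩⟩
    rintro ⟨x | y, hy, rfl⟩
    exacts [hs ⟨x, hy⟩, hy]
  rw [← himage]
  refine connected_induce_image ?_ hC
  rintro (a | a) - (b | b) - hab <;> simp_all

lemma roots_mem_of_connected_induce_graft {C : Set (V ⊕ W)}
    (hC : ((graft G r H s).induce C).Connected) {a : V} {b : W} (ha : .inl a ∈ C)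
    (hb : .inr b ∈ C) : .inl r ∈ C ∧ .inr s ∈ C := by
  by_contra hrs
  have : (Sum.inl a : V ⊕ W).isLeft = (Sum.inr b : V ⊕ W).isLeft := by
    refine eq_of_connected_induce (f := Sum.isLeft) ?_ hC ha hb
    rintro (x | x) hx (y | y) hy hxy <;> simp_all
  simp at this

theorem connected_induce_graft_iff {C : Set (V ⊕ W)} :
    ((graft G r H s).induce C).Connected ↔
      (G.induce (Sum.inl ⁻¹' C)).Connected ∧ Sum.inr ⁻¹' C = ∅ ∨
      Sum.inl ⁻¹' C = ∅ ∧ (H.induce (Sum.inr ⁻¹' C)).Connected ∨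
      ((G.induce (Sum.inl ⁻¹' C)).Connected ∧ .inl r ∈ C) ∧
        (H.induce (Sum.inr ⁻¹' C)).Connected ∧ .inr s ∈ C := by
  constructor
  · intro hC
    rcases (Sum.inr ⁻¹' C).eq_empty_or_nonempty with hr | ⟨b, hb⟩
    · exact .inl ⟨connected_induce_preimage_inl hC (by simp [hr]), hr⟩
    rcases (Sum.inl ⁻¹' C).eq_empty_or_nonempty with hl | ⟨a, ha⟩
    · exact .inr (.inl ⟨hl, connected_induce_preimage_inr hC (by simp [hl])⟩)
    obtain ⟨hr, hs⟩ := roots_mem_of_connected_induce_graft hC ha hb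
    exact .inr (.inr ⟨⟨connected_induce_preimage_inl hC fun _ ↦ hr, hr⟩,
      connected_induce_preimage_inr hC fun _ ↦ hs, hs⟩)
  · have hG (h : (G.induce (Sum.inl ⁻¹' C)).Connected) :
        ((graft G r H s).induce (Sum.inl '' (Sum.inl ⁻¹' C))).Connected :=
      connected_induce_image (fun _ _ _ _ hab ↦ .inr (graft_adj_inl_inl.2 hab)) h
    have hH (h : (H.induce (Sum.inr ⁻¹' C)).Connected) :
        ((graft G r H s).induce (Sum.inr '' (Sum.inr ⁻¹' C))).Connected :=
      connected_induce_image (fun _ _ _ _ hab ↦ .inr (graft_adj_inr_inr.2 hab)) h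
    have hC := image_preimage_inl_union_image_preimage_inr C
    rintro (⟨h, hr⟩ | ⟨hl, h⟩ | ⟨⟨h, hr⟩, h', hs⟩)
    · rw [← hC, hr, image_empty, union_empty]
      exact hG h
    · rw [← hC, hl, image_empty, empty_union]
      exact hH h
    · rw [← hC]
      exact connected_induce_union (v := .inl r) (w := .inr s) (hG h).preconnected
        (hH h').preconnected ⟨r, hr, rfl⟩ ⟨s, hs, rfl⟩ (by simp)

end Graft

section Counting

variable {V W : Type*} {G : SimpleGraph V} {H : SimpleGraph W} {r v : V} {s : W}

/-- The vertex sets inducing a connected subgraph of `G`. In a tree they correspond to the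
subtrees. -/
def connectedSets (G : SimpleGraph V) : Set (Set V) :=
  {A | (G.induce A).Connected}

/-- The connected vertex sets of `G` that contain `v`. -/
def connectedSetsAt (G : SimpleGraph V) (v : V) : Set (Set V) :=
  {A ∈ connectedSets G | v ∈ A}

/-- The connected vertex sets of `G` that do not contain `v`. -/
def connectedSetsAvoiding (G : SimpleGraph V) (v : V) : Set (Set V) :=
  {A ∈ connectedSets G | v ∉ A}

lemma isInduced_of_mem_subtrees (hG : G.IsAcyclic) {S : G.Subgraph} (hS : S ∈ subtrees G) :
    S.IsInduced := by
  intro a ha b hb hab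
  by_contra hSab
  refine isAcyclic_iff_forall_adj_isBridge.1 hG hab (reachable_of_forall_adj (f := Subtype.val)
    (fun x y hxy ↦ .inr ?_) (hS.connected.preconnected ⟨a, ha⟩ ⟨b, hb⟩))
  have hxy' : S.Adj x y := hxy
  refine deleteEdges_adj.2 ⟨hxy'.adj_sub, fun h ↦ hSab ?_⟩
  rcases Sym2.eq_iff.1 h with ⟨hx, hy⟩ | ⟨hx, hy⟩
  exacts [hx ▸ hy ▸ hxy', hx ▸ hy ▸ hxy'.symm]

lemma injOn_verts_subtrees (hG : G.IsAcyclic) : InjOn Subgraph.verts (subtrees G) := by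
  intro S hS S' hS' h
  rw [← (isInduced_of_mem_subtrees hG hS).induce_top_verts, h,
    (isInduced_of_mem_subtrees hG hS').induce_top_verts]

lemma image_verts_subtrees (hG : G.IsAcyclic) :
    Subgraph.verts '' subtrees G = connectedSets G := by
  ext A
  constructor
  · rintro ⟨S, hS, rfl⟩
    exact Subgraph.Connected.induce_verts ⟨hS.connected⟩
  · intro hA
    have htree : (G.induce A).IsTree := ⟨hA, hG.induce A⟩
    rw [induce_eq_coe_induce_top] at htree
    exact ⟨(⊤ : G.Subgraph).induce A, htree, rfl⟩

lemma ncard_subtrees (hG : G.IsAcyclic) : (subtrees G).ncard = (connectedSets G).ncard := by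
  rw [← image_verts_subtrees hG, (injOn_verts_subtrees hG).ncard_image]

lemma ncard_subtreesAt (hG : G.IsAcyclic) (v : V) :
    (subtreesAt G v).ncard = (connectedSetsAt G v).ncard := by
  have himage : Subgraph.verts '' subtreesAt G v = connectedSetsAt G v := by
    rw [connectedSetsAt, ← image_verts_subtrees hG]
    exact image_inter_preimage Subgraph.verts (subtrees G) {A | v ∈ A}
  rw [← himage, ((injOn_verts_subtrees hG).mono fun S hS ↦ hS.1).ncard_image]

lemma ncard_connectedSets [Finite V] (G : SimpleGraph V) (v : V) :
    (connectedSets G).ncard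
      = (connectedSetsAt G v).ncard + (connectedSetsAvoiding G v).ncard :=
  (ncard_inter_add_ncard_sdiff_eq_ncard (connectedSets G) {A | v ∈ A}).symm

lemma empty_notMem_connectedSets : ∅ ∉ connectedSets G := fun h ↦
  h.nonempty.elim Subtype.prop

lemma connectedSetsAt_graft_inl :
    connectedSetsAt (graft G r H s) (.inl r)
      = Set.sumEquiv ⁻¹' (connectedSetsAt G r ×ˢ insert ∅ (connectedSetsAt H s)) := by
  ext C
  have hC : .inl r ∈ C → Sum.inl ⁻¹' C ≠ ∅ := fun hr ↦ Nonempty.ne_empty ⟨r, hr⟩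
  change ((graft G r H s).induce C).Connected ∧ .inl r ∈ C ↔
    ((G.induce (Sum.inl ⁻¹' C)).Connected ∧ .inl r ∈ C) ∧
      (Sum.inr ⁻¹' C = ∅ ∨ (H.induce (Sum.inr ⁻¹' C)).Connected ∧ .inr s ∈ C)
  rw [connected_induce_graft_iff]
  tauto

lemma connectedSetsAvoiding_graft_inl :
    connectedSetsAvoiding (graft G r H s) (.inl r)
      = Set.sumEquiv ⁻¹' (connectedSetsAvoiding G r ×ˢ {∅} ∪ {∅} ×ˢ connectedSets H) := by
  ext C
  have hC : Sum.inl ⁻¹' C = ∅ → .inl r ∉ C := fun h hr ↦ h.subset hr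
  change ((graft G r H s).induce C).Connected ∧ .inl r ∉ C ↔
    ((G.induce (Sum.inl ⁻¹' C)).Connected ∧ .inl r ∉ C) ∧ Sum.inr ⁻¹' C = ∅ ∨
      Sum.inl ⁻¹' C = ∅ ∧ (H.induce (Sum.inr ⁻¹' C)).Connected
  rw [connected_induce_graft_iff]
  tauto

lemma ncard_sumEquiv_preimage (P : Set (Set V × Set W)) : (Set.sumEquiv ⁻¹' P).ncard = P.ncard :=
  ncard_preimage_of_injective_subset_range Set.sumEquiv.injective (by simp)

lemma ncard_connectedSetsAt_graft [Finite W] :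
    (connectedSetsAt (graft G r H s) (.inl r)).ncard
      = (connectedSetsAt G r).ncard * (1 + (connectedSetsAt H s).ncard) := by
  rw [connectedSetsAt_graft_inl, ncard_sumEquiv_preimage, ncard_prod,
    ncard_insert_of_notMem fun h ↦ h.2, add_comm 1]

lemma ncard_connectedSetsAvoiding_graft [Finite V] [Finite W] :
    (connectedSetsAvoiding (graft G r H s) (.inl r)).ncard
      = (connectedSetsAvoiding G r).ncard + (connectedSets H).ncard := by
  rw [connectedSetsAvoiding_graft_inl, ncard_sumEquiv_preimage, ncard_union_eq, ncard_prod,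
    ncard_prod, ncard_singleton, ncard_singleton, mul_one, one_mul]
  rw [Set.disjoint_left]
  rintro ⟨A, B⟩ ⟨hA, -⟩ ⟨rfl : A = ∅, -⟩
  exact empty_notMem_connectedSets hA.1

lemma connectedSetsAt_of_subsingleton [Subsingleton V] : connectedSetsAt G v = {{v}} := by
  ext A
  constructor
  · exact fun hA ↦ subsingleton_of_subsingleton.eq_singleton_of_mem hA.2
  · rintro rfl
    exact ⟨.of_subsingleton, mem_singleton v⟩

lemma connectedSetsAvoiding_of_subsingleton [Subsingleton V] : connectedSetsAvoiding G v = ∅ := by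
  refine eq_empty_of_forall_notMem fun A hA ↦ ?_
  obtain ⟨a, ha⟩ := hA.1.nonempty
  exact hA.2 (Subsingleton.elim a v ▸ ha)

end Counting

section Cut

variable {V : Type*} {G : SimpleGraph V} {A : Set V} {v w : V}

lemma exists_cut_of_isBridge (hvw : G.IsBridge s(v, w)) :
    ∃ A : Set V, v ∈ A ∧ w ∉ A ∧ ∀ a ∈ A, ∀ b ∉ A, G.Adj a b → a = v ∧ b = w := by
  refine ⟨{x | (G.deleteEdges {s(v, w)}).Reachable v x}, Reachable.rfl, hvw,
    fun a ha b hb hab ↦ ?_⟩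
  by_contra h
  refine hb (ha.trans (Adj.reachable (deleteEdges_adj.2 ⟨hab, fun hedge ↦ ?_⟩)))
  rcases Sym2.eq_iff.1 hedge with hab' | ⟨rfl, rfl⟩
  exacts [h hab', hvw ha]

lemma connected_induce_of_cut (hG : G.Connected) (hv : v ∈ A)
    (hA : ∀ a ∈ A, ∀ b ∉ A, G.Adj a b → a = v) : (G.induce A).Connected := by
  classical
  have : Nonempty A := ⟨⟨v, hv⟩⟩
  refine ⟨fun x y ↦ ?_⟩
  have hxy := reachable_of_forall_adj (H := G.induce A)
    (f := fun a ↦ if ha : a ∈ A then ⟨a, ha⟩ else ⟨v, hv⟩) ?_ (hG.preconnected x y)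
  · simpa using hxy
  intro a b hab
  by_cases ha : a ∈ A <;> by_cases hb : b ∈ A
  · simp [ha, hb, hab]
  · simp [hb, hA a ha b hb hab]
  · simp [ha, hA b hb a ha hab.symm]
  · simp [ha, hb]

open Classical in
/-- A graph with a single edge `vw` between `A` and its complement is a graft of its two sides. -/
noncomputable def graftInduceIso (hv : v ∈ A) (hw : w ∉ A) (hvw : G.Adj v w)
    (hA : ∀ a ∈ A, ∀ b ∉ A, G.Adj a b → a = v ∧ b = w) :
    graft (G.induce A) ⟨v, hv⟩ (G.induce Aᶜ) ⟨w, hw⟩ ≃g G where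
  toEquiv := Equiv.Set.sumCompl A
  map_rel_iff' := by
    have hadj {a b} (ha : a ∈ A) (hb : b ∉ A) : G.Adj a b ↔ a = v ∧ b = w :=
      ⟨hA a ha b hb, fun h ↦ h.1 ▸ h.2 ▸ hvw⟩
    rintro (⟨a, ha⟩ | ⟨a, ha⟩) (⟨b, hb⟩ | ⟨b, hb⟩)
    · simp
    · simp [hadj ha hb]
    · simp [G.adj_comm a b, hadj hb ha]
    · simp

end Cut

section Isomorphism

variable {V W : Type*} {G : SimpleGraph V} {H : SimpleGraph W}

lemma ncard_preimage_preimage_iso (e : G ≃g H) (P : Set (Set V)) :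
    (preimage e ⁻¹' P).ncard = P.ncard :=
  ncard_preimage_of_injective_subset_range e.surjective.preimage_injective
    ((preimage_surjective.2 e.injective).range_eq ▸ subset_univ P)

lemma ncard_connectedSetsAt_iso (e : G ≃g H) (v : V) :
    (connectedSetsAt H (e v)).ncard = (connectedSetsAt G v).ncard := by
  rw [← ncard_preimage_preimage_iso e]
  exact congrArg ncard (Set.ext fun A ↦ and_congr_left' (connected_induce_preimage_iso e).symm)

lemma ncard_connectedSetsAvoiding_iso (e : G ≃g H) (v : V) :
    (connectedSetsAvoiding H (e v)).ncard = (connectedSetsAvoiding G v).ncard := by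
  rw [← ncard_preimage_preimage_iso e]
  exact congrArg ncard (Set.ext fun A ↦ and_congr_left' (connected_induce_preimage_iso e).symm)

lemma ncard_neighborSet_iso (e : G ≃g H) (v : V) :
    (H.neighborSet (e v)).ncard = (G.neighborSet v).ncard := by
  rw [← e.image_neighborSet, ncard_image_of_injective _ e.injective]

end Isomorphism

/-- A finite tree with a distinguished vertex. (Mathlib's `RootedTree` is an order-theoretic
notion.) -/
structure PointedTree where
  carrier : Type u
  [finite : Finite carrier]
  graph : SimpleGraph carrier
  root : carrier
  isTree : graph.IsTree

namespace PointedTree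

attribute [instance] finite

variable {T U : PointedTree.{u}} {k : ℕ}

/-- The number of vertices. -/
noncomputable def order (T : PointedTree.{u}) : ℕ := Nat.card T.carrier

/-- The degree of the root. -/
noncomputable def rootDegree (T : PointedTree.{u}) : ℕ := (T.graph.neighborSet T.root).ncard

/-- The number of subtrees containing the root, counted by their vertex sets. -/
noncomputable def numAt (T : PointedTree.{u}) : ℕ := (connectedSetsAt T.graph T.root).ncard

/-- The number of subtrees not containing the root, counted by their vertex sets. -/
noncomputable def numAvoiding (T : PointedTree.{u}) : ℕ :=
  (connectedSetsAvoiding T.graph T.root).ncard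

/-- The odds that a random subtree misses the root. Unlike the probability `prob`, these odds
transform almost affinely under `plant`. -/
noncomputable def ratio (T : PointedTree.{u}) : ℝ := T.numAvoiding / T.numAt

/-- The probability that a random subtree contains the root. -/
noncomputable def prob (T : PointedTree.{u}) : ℝ := subtreeProb T.graph T.root

/-- Every vertex other than the root has degree different from 2. -/
def IsReducedOffRoot (T : PointedTree.{u}) : Prop :=
  ∀ v ≠ T.root, (T.graph.neighborSet v).ncard ≠ 2

/-- Isomorphism of trees preserving the root. -/
def Iso (T U : PointedTree.{u}) : Prop :=
  ∃ e : T.graph ≃g U.graph, e T.root = U.root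

/-- The tree with a single vertex. -/
def single : PointedTree.{u} where
  carrier := PUnit
  graph := ⊥
  root := PUnit.unit
  isTree := .of_subsingleton

/-- The tree obtained from `T` by joining its root, which stays the root, to the root of `U`. -/
def graft (T U : PointedTree.{u}) : PointedTree.{u} where
  carrier := T.carrier ⊕ U.carrier
  graph := _root_.graft T.graph T.root U.graph U.root
  root := .inl T.root
  isTree := isTree_graft T.isTree U.isTree T.root U.root

/-- The tree obtained from `T` by attaching `k` leaves to its root. -/
def addLeaves (T : PointedTree.{u}) : ℕ → PointedTree.{u}
  | 0 => T
  | k + 1 => (T.addLeaves k).graft single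

/-- The tree whose root is a new vertex, joined to the root of `T` and to `k` leaves. -/
def plant (T : PointedTree.{u}) (k : ℕ) : PointedTree.{u} :=
  (single.graft T).addLeaves k

lemma numAt_pos (T : PointedTree.{u}) : 0 < T.numAt :=
  (ncard_pos (toFinite _)).2 ⟨{T.root}, .of_subsingleton, rfl⟩

lemma order_pos (T : PointedTree.{u}) : 0 < T.order :=
  have := T.isTree.connected.nonempty
  Nat.card_pos

lemma rootDegree_lt_order (T : PointedTree.{u}) : T.rootDegree < T.order :=
  ncard_lt_card fun h ↦ T.graph.notMem_neighborSet_self (h.symm ▸ mem_univ T.root)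

lemma prob_eq_inv_one_add_ratio (T : PointedTree.{u}) : T.prob = (1 + T.ratio)⁻¹ := by
  have hpos : (0 : ℝ) < T.numAt := mod_cast T.numAt_pos
  rw [prob, subtreeProb, ncard_subtreesAt T.isTree.isAcyclic, ncard_subtrees T.isTree.isAcyclic,
    ncard_connectedSets T.graph T.root]
  change (T.numAt : ℝ) / ((T.numAt + T.numAvoiding : ℕ) : ℝ) = _
  rw [ratio]
  push_cast
  field_simp

section Iso

lemma Iso.order_eq (h : Iso T U) : U.order = T.order :=
  Nat.card_congr h.choose.toEquiv.symm

lemma Iso.rootDegree_eq (h : Iso T U) : U.rootDegree = T.rootDegree := by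
  obtain ⟨e, he⟩ := h
  rw [rootDegree, ← he, ncard_neighborSet_iso, rootDegree]

lemma Iso.numAt_eq (h : Iso T U) : U.numAt = T.numAt := by
  obtain ⟨e, he⟩ := h
  rw [numAt, ← he, ncard_connectedSetsAt_iso, numAt]

lemma Iso.numAvoiding_eq (h : Iso T U) : U.numAvoiding = T.numAvoiding := by
  obtain ⟨e, he⟩ := h
  rw [numAvoiding, ← he, ncard_connectedSetsAvoiding_iso, numAvoiding]

lemma Iso.isReducedOffRoot (h : Iso T U) (hU : U.IsReducedOffRoot) : T.IsReducedOffRoot := by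
  obtain ⟨e, he⟩ := h
  intro v hv
  rw [← ncard_neighborSet_iso e]
  exact hU (e v) (he ▸ e.injective.ne hv)

end Iso

section Subsingleton

variable [Subsingleton T.carrier]

lemma order_of_subsingleton : T.order = 1 :=
  have := T.isTree.connected.nonempty
  Nat.card_eq_one_iff_unique.2 ⟨inferInstance, inferInstance⟩

lemma rootDegree_of_subsingleton : T.rootDegree = 0 := by
  have := T.rootDegree_lt_order
  rw [order_of_subsingleton] at this
  lia

lemma numAt_of_subsingleton : T.numAt = 1 := by
  rw [numAt, connectedSetsAt_of_subsingleton, ncard_singleton]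

lemma numAvoiding_of_subsingleton : T.numAvoiding = 0 := by
  rw [numAvoiding, connectedSetsAvoiding_of_subsingleton, ncard_empty]

lemma isReducedOffRoot_of_subsingleton : T.IsReducedOffRoot :=
  fun v hv ↦ (hv (Subsingleton.elim v T.root)).elim

instance : Subsingleton (single : PointedTree.{u}).carrier := inferInstanceAs (Subsingleton PUnit)

end Subsingleton

section Graft

lemma order_graft (T U : PointedTree.{u}) : (T.graft U).order = T.order + U.order :=
  Nat.card_sum

lemma rootDegree_graft (T U : PointedTree.{u}) : (T.graft U).rootDegree = T.rootDegree + 1 :=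
  ncard_neighborSet_graft_inl_root

lemma numAt_graft (T U : PointedTree.{u}) : (T.graft U).numAt = T.numAt * (1 + U.numAt) :=
  ncard_connectedSetsAt_graft

lemma numAvoiding_graft (T U : PointedTree.{u}) :
    (T.graft U).numAvoiding = T.numAvoiding + (U.numAt + U.numAvoiding) := by
  rw [numAvoiding, graft, ncard_connectedSetsAvoiding_graft, ncard_connectedSets U.graph U.root]
  rfl

lemma isReducedOffRoot_graft_iff :
    (T.graft U).IsReducedOffRoot ↔
      T.IsReducedOffRoot ∧ U.IsReducedOffRoot ∧ U.rootDegree ≠ 1 := by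
  have hroot : ((T.graft U).graph.neighborSet (.inr U.root)).ncard = U.rootDegree + 1 :=
    ncard_neighborSet_graft_inr_root
  constructor
  · refine fun h ↦ ⟨fun v hv ↦ ?_, fun v hv ↦ ?_, fun hU ↦ h (.inr U.root) Sum.inr_ne_inl ?_⟩
    · rw [← ncard_neighborSet_graft_inl hv]
      exact h (.inl v) (Sum.inl_injective.ne hv)
    · rw [← ncard_neighborSet_graft_inr hv]
      exact h (.inr v) Sum.inr_ne_inl
    · rw [hroot, hU]
  · rintro ⟨hT, hU, hdeg⟩ (v | v) hv
    · have hv : v ≠ T.root := ne_of_apply_ne Sum.inl hv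
      exact (ncard_neighborSet_graft_inl hv).trans_ne (hT v hv)
    · obtain rfl | hv := eq_or_ne v U.root
      · rw [hroot]
        simpa using hdeg
      · exact (ncard_neighborSet_graft_inr hv).trans_ne (hU v hv)

lemma exists_iso_graft [Nontrivial T.carrier] : ∃ T₁ T₂ : PointedTree.{u}, Iso (T₁.graft T₂) T := by
  obtain ⟨w, hw⟩ := T.isTree.connected.preconnected.exists_adj_of_nontrivial T.root
  obtain ⟨A, hrA, hwA, hA⟩ :=
    exists_cut_of_isBridge (isAcyclic_iff_forall_adj_isBridge.1 T.isTree.isAcyclic hw)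
  have hAtree : (T.graph.induce A).IsTree :=
    ⟨connected_induce_of_cut T.isTree.connected hrA fun a ha b hb hab ↦ (hA a ha b hb hab).1,
      T.isTree.isAcyclic.induce A⟩
  have hAtree' : (T.graph.induce Aᶜ).IsTree :=
    ⟨connected_induce_of_cut T.isTree.connected hwA
      fun b hb a ha hab ↦ (hA a (not_not.1 ha) b hb hab.symm).2, T.isTree.isAcyclic.induce Aᶜ⟩
  exact ⟨⟨A, _, ⟨T.root, hrA⟩, hAtree⟩, ⟨↥Aᶜ, _, ⟨w, hwA⟩, hAtree'⟩,
    graftInduceIso hrA hwA hw hA, rfl⟩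

@[elab_as_elim]
theorem graft_induction {motive : PointedTree.{u} → Prop}
    (iso : ∀ T U, Iso T U → motive T → motive U)
    (subsingleton : ∀ T : PointedTree.{u}, Subsingleton T.carrier → motive T)
    (graft : ∀ T U, motive T → motive U → motive (T.graft U)) (T : PointedTree.{u}) :
    motive T := by
  induction hn : T.order using Nat.strong_induction_on generalizing T with
  | _ n ih =>
    obtain hT | hT := subsingleton_or_nontrivial T.carrier
    · exact subsingleton T hT
    obtain ⟨T₁, T₂, hiso⟩ := exists_iso_graft (T := T)
    have horder := hiso.order_eq
    rw [order_graft] at horder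
    have h₁ := T₁.order_pos
    have h₂ := T₂.order_pos
    exact iso _ T hiso (graft T₁ T₂ (ih _ (by lia) T₁ rfl) (ih _ (by lia) T₂ rfl))

end Graft

section Plant

lemma rootDegree_addLeaves : (T.addLeaves k).rootDegree = T.rootDegree + k := by
  induction k with
  | zero => rfl
  | succ k ih => rw [addLeaves, rootDegree_graft, ih, add_assoc]

lemma numAt_addLeaves : (T.addLeaves k).numAt = 2 ^ k * T.numAt := by
  induction k with
  | zero => simp [addLeaves]
  | succ k ih =>
    rw [addLeaves, numAt_graft, ih, numAt_of_subsingleton (T := single)]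
    ring

lemma numAvoiding_addLeaves : (T.addLeaves k).numAvoiding = T.numAvoiding + k := by
  induction k with
  | zero => rfl
  | succ k ih =>
    rw [addLeaves, numAvoiding_graft, ih, numAt_of_subsingleton (T := single),
      numAvoiding_of_subsingleton (T := single), add_assoc]

lemma isReducedOffRoot_addLeaves_iff : (T.addLeaves k).IsReducedOffRoot ↔ T.IsReducedOffRoot := by
  induction k with
  | zero => rfl
  | succ k ih =>
    simp [addLeaves, isReducedOffRoot_graft_iff, ih, isReducedOffRoot_of_subsingleton,
      rootDegree_of_subsingleton]

lemma rootDegree_plant : (T.plant k).rootDegree = k + 1 := by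
  rw [plant, rootDegree_addLeaves, rootDegree_graft, rootDegree_of_subsingleton]
  ring

lemma numAt_plant : (T.plant k).numAt = 2 ^ k * (1 + T.numAt) := by
  rw [plant, numAt_addLeaves, numAt_graft, numAt_of_subsingleton, one_mul]

lemma numAvoiding_plant : (T.plant k).numAvoiding = T.numAt + T.numAvoiding + k := by
  rw [plant, numAvoiding_addLeaves, numAvoiding_graft, numAvoiding_of_subsingleton, zero_add]

lemma isReducedOffRoot_plant_iff :
    (T.plant k).IsReducedOffRoot ↔ T.IsReducedOffRoot ∧ T.rootDegree ≠ 1 := by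
  simp [plant, isReducedOffRoot_addLeaves_iff, isReducedOffRoot_graft_iff,
    isReducedOffRoot_of_subsingleton]

lemma order_plant_zero : (T.plant 0).order = 1 + T.order := by
  rw [plant, addLeaves, order_graft, order_of_subsingleton]

end Plant

section Bounds

lemma order_le_numAvoiding_add_one (T : PointedTree.{u}) : T.order ≤ T.numAvoiding + 1 := by
  induction T using graft_induction with
  | iso T U h ih => rwa [h.order_eq, h.numAvoiding_eq]
  | subsingleton T hT => rw [order_of_subsingleton, numAvoiding_of_subsingleton]
  | graft T U hT hU =>
    rw [order_graft, numAvoiding_graft]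
    have := U.numAt_pos
    lia

lemma rootDegree_le_numAvoiding (T : PointedTree.{u}) : T.rootDegree ≤ T.numAvoiding := by
  have := T.rootDegree_lt_order
  have := T.order_le_numAvoiding_add_one
  lia

lemma two_pow_rootDegree_le_numAt (T : PointedTree.{u}) : 2 ^ T.rootDegree ≤ T.numAt := by
  induction T using graft_induction with
  | iso T U h ih => rwa [h.rootDegree_eq, h.numAt_eq]
  | subsingleton T hT => rw [rootDegree_of_subsingleton, numAt_of_subsingleton, pow_zero]
  | graft T U hT =>
    rw [rootDegree_graft, numAt_graft, pow_succ]
    have := U.numAt_pos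
    gcongr
    lia

lemma subsingleton_of_rootDegree_eq_zero (h : T.rootDegree = 0) : Subsingleton T.carrier := by
  by_contra hT
  rw [not_subsingleton_iff_nontrivial] at hT
  obtain ⟨w, hw⟩ := T.isTree.connected.preconnected.exists_adj_of_nontrivial T.root
  exact ((ncard_eq_zero (toFinite _)).1 h).subset hw

lemma numAt_add_order_le (h : T.rootDegree = 1) : T.numAt + T.order ≤ T.numAvoiding + 3 := by
  induction T using graft_induction with
  | iso T U hiso ih =>
    rw [hiso.numAt_eq, hiso.order_eq, hiso.numAvoiding_eq]
    exact ih (hiso.rootDegree_eq ▸ h)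
  | subsingleton T hT => simp [rootDegree_of_subsingleton] at h
  | graft T U =>
    rw [rootDegree_graft, Nat.add_eq_right] at h
    have := subsingleton_of_rootDegree_eq_zero h
    have := U.order_le_numAvoiding_add_one
    rw [numAt_graft, order_graft, numAvoiding_graft, numAt_of_subsingleton, order_of_subsingleton,
      numAvoiding_of_subsingleton]
    lia

/-- The invariant behind the upper bounds on `ratio`. If the branches at the root contribute factors
`tᵢ ≥ 2` to `numAt = ∏ tᵢ`, then `numAvoiding ≤ ∑ (2 * tᵢ - 3)` as long as no branch has a root of
degree 1, and the invariant is what remains after linearizing the product at `tᵢ = 2`. -/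
def BranchBound (T : PointedTree.{u}) : Prop :=
  2 ^ T.rootDegree * (T.numAvoiding + 4) ≤ 4 * T.numAt + T.rootDegree * 2 ^ T.rootDegree

lemma BranchBound.graft (hT : T.BranchBound) (hU : U.numAvoiding < U.numAt) :
    (T.graft U).BranchBound := by
  have hpow := T.two_pow_rootDegree_le_numAt
  obtain ⟨m, hm⟩ : ∃ m, U.numAt = m + 1 := Nat.exists_eq_add_one.2 U.numAt_pos
  have hmul : 2 ^ T.rootDegree * m ≤ T.numAt * m := by gcongr
  rw [BranchBound] at hT ⊢
  rw [rootDegree_graft, numAvoiding_graft, numAt_graft, pow_succ, hm]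
  have hUm : U.numAvoiding ≤ m := by lia
  have hmul' : 2 ^ T.rootDegree * U.numAvoiding ≤ 2 ^ T.rootDegree * m := by gcongr
  linear_combination 2 * hT + 4 * hmul + 2 * hmul'

lemma BranchBound.numAvoiding_add_three_le (hT : T.BranchBound) (hd : T.rootDegree = 1) :
    T.numAvoiding + 3 ≤ 2 * T.numAt := by
  rw [BranchBound, hd] at hT
  lia

lemma BranchBound.two_mul_numAvoiding_le (hT : T.BranchBound) (hd : 3 ≤ T.rootDegree) :
    2 * T.numAvoiding ≤ T.numAt := by
  obtain ⟨e, he⟩ := Nat.exists_eq_add_of_le hd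
  obtain ⟨m, hm⟩ := Nat.exists_eq_add_of_le T.rootDegree_le_numAvoiding
  have hpow : e + 1 ≤ 2 ^ e := Nat.lt_two_pow_self
  have hprod : (e + 1) * (m + 4) ≤ 2 ^ e * (m + 4) := by gcongr
  rw [BranchBound, hm, he, pow_add] at hT
  rw [hm, he]
  nlinarith

lemma BranchBound.numAvoiding_lt_numAt (hT : T.BranchBound) (hd : T.rootDegree ≠ 1) :
    T.numAvoiding < T.numAt := by
  obtain h0 | h2 | h3 : T.rootDegree = 0 ∨ T.rootDegree = 2 ∨ 3 ≤ T.rootDegree := by lia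
  · have := subsingleton_of_rootDegree_eq_zero h0
    rw [numAvoiding_of_subsingleton, numAt_of_subsingleton]
    exact one_pos
  · rw [BranchBound, h2] at hT
    lia
  · have := hT.two_mul_numAvoiding_le h3
    have := T.numAt_pos
    lia

theorem IsReducedOffRoot.branchBound (hT : T.IsReducedOffRoot) : T.BranchBound := by
  induction T using graft_induction with
  | iso T U h ih =>
    rw [BranchBound, h.rootDegree_eq, h.numAt_eq, h.numAvoiding_eq]
    exact ih (h.isReducedOffRoot hT)
  | subsingleton T =>
    simp [BranchBound, rootDegree_of_subsingleton, numAt_of_subsingleton,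
      numAvoiding_of_subsingleton]
  | graft T U ihT ihU =>
    obtain ⟨hT, hU, hd⟩ := isReducedOffRoot_graft_iff.1 hT
    exact (ihT hT).graft ((ihU hU).numAvoiding_lt_numAt hd)

lemma ratio_nonneg (T : PointedTree.{u}) : 0 ≤ T.ratio := by
  rw [ratio]
  positivity

lemma ratio_mem_Icc_of_rootDegree_eq_one (hT : T.IsReducedOffRoot) (hd : T.rootDegree = 1)
    (horder : 2 < T.order) : T.ratio ∈ Icc 1 2 := by
  have hlower := numAt_add_order_le hd
  have hupper := hT.branchBound.numAvoiding_add_three_le hd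
  have hpos : (0 : ℝ) < T.numAt := mod_cast T.numAt_pos
  rw [ratio, mem_Icc, one_le_div hpos, div_le_iff₀ hpos]
  norm_cast
  lia

lemma ratio_mem_Icc_of_three_le_rootDegree (hT : T.IsReducedOffRoot) (hd : 3 ≤ T.rootDegree) :
    T.ratio ∈ Icc 0 2⁻¹ := by
  have hupper : (2 * T.numAvoiding : ℝ) ≤ T.numAt :=
    mod_cast hT.branchBound.two_mul_numAvoiding_le hd
  have hpos : (0 : ℝ) < T.numAt := mod_cast T.numAt_pos
  refine ⟨T.ratio_nonneg, ?_⟩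
  rw [ratio, div_le_iff₀ hpos]
  linarith

lemma prob_mem_Icc {x y : ℝ} (hx : 0 ≤ x) (h : T.ratio ∈ Icc x y) :
    T.prob ∈ Icc (1 + y)⁻¹ (1 + x)⁻¹ := by
  have := T.ratio_nonneg
  rw [prob_eq_inv_one_add_ratio]
  exact ⟨by gcongr; exact h.2, by gcongr; exact h.1⟩

lemma prob_mem_Icc_zero_one (T : PointedTree.{u}) : T.prob ∈ Icc 0 1 := by
  have h := prob_mem_Icc le_rfl ⟨T.ratio_nonneg, le_rfl⟩
  have := T.ratio_nonneg
  refine ⟨le_trans (by positivity) h.1, by simpa using h.2⟩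

lemma isSeriesReduced_graph_iff :
    IsSeriesReduced T.graph ↔ T.IsReducedOffRoot ∧ T.rootDegree ≠ 2 := by
  refine ⟨fun h ↦ ⟨fun v _ ↦ h v, h T.root⟩, fun h v ↦ ?_⟩
  obtain rfl | hv := eq_or_ne v T.root
  exacts [h.2, h.1 v hv]

theorem prob_mem_Icc_of_isLeafOf_root (hT : IsSeriesReduced T.graph) (horder : 2 < T.order)
    (hroot : IsLeafOf T.graph T.root) : T.prob ∈ Icc (1 / 3) (1 / 2) := by
  have h := ratio_mem_Icc_of_rootDegree_eq_one (isSeriesReduced_graph_iff.1 hT).1 hroot horder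
  convert prob_mem_Icc zero_le_one h using 2 <;> norm_num

theorem prob_mem_Icc_of_not_isLeafOf_root (hT : IsSeriesReduced T.graph) (horder : 2 < T.order)
    (hroot : ¬ IsLeafOf T.graph T.root) : T.prob ∈ Icc (2 / 3) 1 := by
  have hd : T.rootDegree ≠ 0 := fun h ↦ by
    have := subsingleton_of_rootDegree_eq_zero h
    rw [order_of_subsingleton] at horder
    lia
  obtain ⟨hred, hd2⟩ := isSeriesReduced_graph_iff.1 hT
  have hd1 : T.rootDegree ≠ 1 := hroot
  convert prob_mem_Icc le_rfl (ratio_mem_Icc_of_three_le_rootDegree hred (by lia)) using 2 <;>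
    norm_num

end Bounds

section Density

variable {S S' : Set PointedTree.{u}} {x y : ℝ}

/-- The cluster points of `ratio` along trees in `S` for which `numAt` tends to infinity. -/
def limitRatios (S : Set PointedTree.{u}) : Set ℝ :=
  {x | MapClusterPt x (comap numAt atTop ⊓ 𝓟 S) ratio}

lemma isClosed_limitRatios (S : Set PointedTree.{u}) : IsClosed (limitRatios S) :=
  isClosed_setOfPred_clusterPt

lemma mem_limitRatios_iff_ultrafilter :
    x ∈ limitRatios S ↔
      ∃ F : Ultrafilter PointedTree.{u}, Tendsto numAt F atTop ∧ S ∈ F ∧ Tendsto ratio F (𝓝 x) := by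
  simp_rw [limitRatios, mem_ofPred_eq, mapClusterPt_iff_ultrafilter, le_inf_iff, tendsto_iff_comap,
    le_principal_iff, and_assoc]
  rfl

lemma limitRatios_mono (h : S ⊆ S') : limitRatios S ⊆ limitRatios S' :=
  fun _ hx ↦ MapClusterPt.mono hx (inf_le_inf_left _ (principal_mono.2 h))

lemma nonneg_of_mem_limitRatios (hx : x ∈ limitRatios S) : 0 ≤ x := by
  obtain ⟨F, -, -, hF⟩ := mem_limitRatios_iff_ultrafilter.1 hx
  exact ge_of_tendsto' hF ratio_nonneg

lemma mem_limitRatios_of_tendsto {t : ℕ → PointedTree.{u}}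
    (hnumAt : Tendsto (fun n ↦ (t n).numAt) atTop atTop) (hS : ∀ᶠ n in atTop, t n ∈ S)
    (hratio : Tendsto (fun n ↦ (t n).ratio) atTop (𝓝 x)) : x ∈ limitRatios S :=
  .of_comp (tendsto_inf.2 ⟨tendsto_comap_iff.2 hnumAt, tendsto_principal.2 hS⟩)
    hratio.mapClusterPt

lemma ratio_plant (T : PointedTree.{u}) (k : ℕ) :
    (T.plant k).ratio = (1 + T.ratio + k / T.numAt) / (2 ^ k * (1 + 1 / T.numAt)) := by
  have hpos : (0 : ℝ) < T.numAt := mod_cast T.numAt_pos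
  rw [ratio, ratio, numAt_plant, numAvoiding_plant]
  push_cast
  field_simp
  ring

lemma tendsto_ratio_plant {F : Filter PointedTree.{u}} (hnumAt : Tendsto numAt F atTop)
    (hratio : Tendsto ratio F (𝓝 x)) (k : ℕ) :
    Tendsto (fun T ↦ (T.plant k).ratio) F (𝓝 ((1 + x) / 2 ^ k)) := by
  have hinv (c : ℝ) : Tendsto (fun T : PointedTree.{u} ↦ c / T.numAt) F (𝓝 0) :=
    (tendsto_natCast_atTop_atTop.comp hnumAt).const_div_atTop c
  have hlim := ((hratio.const_add 1).add (hinv k)).div (((hinv 1).const_add 1).const_mul (2 ^ k))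
    (by positivity)
  simpa only [ratio_plant, Pi.div_def, add_zero, mul_one] using hlim

lemma one_add_div_two_pow_mem_limitRatios (h : MapsTo (plant · k) S S') (hx : x ∈ limitRatios S) :
    (1 + x) / 2 ^ k ∈ limitRatios S' := by
  obtain ⟨F, hnumAt, hS, hratio⟩ := mem_limitRatios_iff_ultrafilter.1 hx
  refine mem_limitRatios_iff_ultrafilter.2 ⟨F.map (plant · k), ?_,
    Ultrafilter.mem_map.2 (mem_of_superset hS h),
    tendsto_map'_iff.2 (tendsto_ratio_plant hnumAt hratio k)⟩
  refine tendsto_map'_iff.2 (tendsto_atTop_mono (fun T ↦ ?_) hnumAt)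
  have := Nat.one_le_two_pow (n := k)
  rw [Function.comp_apply, numAt_plant]
  nlinarith

/-- Trees with root degree at least `n` in which no vertex other than the root has degree 2. -/
def reducedTrees (n : ℕ) : Set PointedTree.{u} :=
  {T | T.IsReducedOffRoot ∧ n ≤ T.rootDegree}

lemma zero_mem_limitRatios_reducedTrees (n : ℕ) : 0 ∈ limitRatios (reducedTrees.{u} n) := by
  refine mem_limitRatios_of_tendsto (t := single.addLeaves) ?_ ?_ ?_
  · simp_rw [numAt_addLeaves, numAt_of_subsingleton, mul_one]
    exact tendsto_pow_atTop_atTop_of_one_lt one_lt_two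
  · filter_upwards [eventually_ge_atTop n] with k hk
    refine ⟨isReducedOffRoot_addLeaves_iff.2 isReducedOffRoot_of_subsingleton, ?_⟩
    rwa [rootDegree_addLeaves, rootDegree_of_subsingleton, zero_add]
  · simp_rw [ratio, numAt_addLeaves, numAvoiding_addLeaves, numAt_of_subsingleton,
      numAvoiding_of_subsingleton, mul_one, zero_add]
    simpa using tendsto_pow_const_div_const_pow_of_one_lt 1 (one_lt_two (α := ℝ))

lemma mapsTo_plant_reducedTrees {m n : ℕ} (hm : 2 ≤ m) (hk : n ≤ k + 1) :
    MapsTo (plant · k) (reducedTrees.{u} m) (reducedTrees n) := by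
  rintro T ⟨hT, hd⟩
  exact ⟨isReducedOffRoot_plant_iff.2 ⟨hT, by lia⟩, rootDegree_plant.symm ▸ hk⟩

lemma exists_eq_one_add_div_two_pow (hy : y ∈ Ioc 0 1) :
    ∃ k : ℕ, 1 ≤ k ∧ ∃ x ∈ Icc (0 : ℝ) 1, y = (1 + x) / 2 ^ k := by
  obtain ⟨n, hlt, hle⟩ := exists_nat_pow_near_of_lt_one hy.1 hy.2 (one_half_pos (α := ℝ))
    one_half_lt_one
  rw [one_div, inv_pow, inv_lt_iff_one_lt_mul₀ (by positivity)] at hlt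
  rw [one_div, inv_pow, le_inv_comm₀ hy.1 (by positivity), le_inv_comm₀ (by positivity) hy.1,
    ← one_div, le_div_iff₀ (by positivity)] at hle
  rw [pow_succ] at hlt
  refine ⟨n + 1, by lia, 2 ^ n * 2 * y - 1, ⟨by linarith, by linarith⟩, ?_⟩
  rw [pow_succ]
  field_simp
  ring

/-- A point of `[0, 1]` farthest from `L` is the image of another point of `[0, 1]` under a map that
preserves `L` and at least halves distances. -/
lemma Icc_zero_one_subset_of_isClosed {L : Set ℝ} (hL : IsClosed L) (h0 : 0 ∈ L)
    (hmap : ∀ k : ℕ, 1 ≤ k → ∀ x ∈ L, (1 + x) / 2 ^ k ∈ L) : Icc 0 1 ⊆ L := by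
  obtain ⟨y, hy, hmax⟩ := isCompact_Icc.exists_isMaxOn (nonempty_Icc.2 zero_le_one)
    (Metric.continuous_infDist_pt L).continuousOn
  suffices hdist : Metric.infDist y L ≤ 0 from fun x hx ↦
    (hL.mem_iff_infDist_zero ⟨0, h0⟩).2 (((hmax hx).trans hdist).antisymm Metric.infDist_nonneg)
  obtain rfl | hy0 := hy.1.eq_or_lt
  · exact (Metric.infDist_zero_of_mem h0).le
  obtain ⟨k, hk, x, hx, rfl⟩ := exists_eq_one_add_div_two_pow ⟨hy0, hy.2⟩
  obtain ⟨z, hz, hxz⟩ := hL.exists_infDist_eq_dist ⟨0, h0⟩ x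
  have hcontract := calc
    Metric.infDist ((1 + x) / 2 ^ k) L ≤ |(1 + x) / 2 ^ k - (1 + z) / 2 ^ k| :=
      Metric.infDist_le_dist_of_mem (hmap k hk z hz)
    _ = |x - z| / 2 ^ k := by
      rw [← sub_div, add_sub_add_left_eq_sub, abs_div, abs_of_pos (by positivity : (0 : ℝ) < 2 ^ k)]
    _ ≤ |x - z| / 2 := by gcongr; exact le_self_pow₀ one_le_two (by lia)
    _ ≤ Metric.infDist ((1 + x) / 2 ^ k) L / 2 := by
      rw [← Real.dist_eq, ← hxz]
      gcongr
      exact hmax hx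
  linarith

lemma Icc_zero_one_subset_limitRatios_reducedTrees_two :
    Icc 0 1 ⊆ limitRatios (reducedTrees.{u} 2) :=
  Icc_zero_one_subset_of_isClosed (isClosed_limitRatios _) (zero_mem_limitRatios_reducedTrees 2)
    fun _ hk _ ↦ one_add_div_two_pow_mem_limitRatios (mapsTo_plant_reducedTrees le_rfl (by lia))

lemma Icc_zero_half_subset_limitRatios_reducedTrees_three :
    Icc 0 2⁻¹ ⊆ limitRatios (reducedTrees.{u} 3) := by
  rintro y ⟨hy0, hy⟩
  obtain rfl | hy0 := hy0.eq_or_lt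
  · exact zero_mem_limitRatios_reducedTrees 3
  obtain ⟨k, hk, x, hx, hxy⟩ := exists_eq_one_add_div_two_pow (y := 2 * y)
    ⟨by positivity, by linarith⟩
  have hy' : y = (1 + x) / 2 ^ (k + 1) := by rw [pow_succ, ← div_div, ← hxy]; ring
  rw [hy']
  exact one_add_div_two_pow_mem_limitRatios (mapsTo_plant_reducedTrees le_rfl (by lia))
    (Icc_zero_one_subset_limitRatios_reducedTrees_two hx)

lemma Icc_one_two_subset_limitRatios :
    Icc 1 2 ⊆ limitRatios {T : PointedTree.{u} |
      T.IsReducedOffRoot ∧ T.rootDegree = 1 ∧ 2 < T.order} := by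
  rintro y ⟨hy1, hy2⟩
  have h : MapsTo (plant · 0) (reducedTrees.{u} 2)
      {T | T.IsReducedOffRoot ∧ T.rootDegree = 1 ∧ 2 < T.order} := by
    rintro T ⟨hT, hd⟩
    have := T.rootDegree_lt_order
    refine ⟨isReducedOffRoot_plant_iff.2 ⟨hT, by lia⟩, rootDegree_plant, ?_⟩
    rw [order_plant_zero]
    lia
  simpa using one_add_div_two_pow_mem_limitRatios h
    (Icc_zero_one_subset_limitRatios_reducedTrees_two (a := y - 1) ⟨by linarith, by linarith⟩)

lemma limitRatios_univ : limitRatios (univ : Set PointedTree.{u}) = Ici 0 := by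
  refine Subset.antisymm (fun x ↦ nonneg_of_mem_limitRatios) fun x hx ↦ ?_
  have h (n : ℕ) : Icc 0 (n + 1 : ℝ) ⊆ limitRatios (univ : Set PointedTree.{u}) := by
    induction n with
    | zero =>
      simpa using Icc_zero_one_subset_limitRatios_reducedTrees_two.trans
        (limitRatios_mono (subset_univ _))
    | succ n ih =>
      rintro y ⟨hy0, hyn⟩
      obtain hy1 | hy1 := le_total y 1
      · exact ih ⟨hy0, by linarith [n.cast_nonneg (α := ℝ)]⟩
      · push_cast at hyn
        simpa using one_add_div_two_pow_mem_limitRatios (mapsTo_univ (plant · 0) univ)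
          (ih (a := y - 1) ⟨by linarith, by linarith⟩)
  exact h ⌊x⌋₊ ⟨hx, (Nat.lt_floor_add_one x).le⟩

lemma inv_one_add_mem_closure_image_prob (hx : x ∈ limitRatios S) :
    (1 + x)⁻¹ ∈ closure (prob '' S) := by
  obtain ⟨F, -, hS, hratio⟩ := mem_limitRatios_iff_ultrafilter.1 hx
  have hx0 := nonneg_of_mem_limitRatios hx
  have hprob : Tendsto prob F (𝓝 (1 + x)⁻¹) :=
    ((hratio.const_add 1).inv₀ (by positivity)).congr fun T ↦ T.prob_eq_inv_one_add_ratio.symm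
  exact mem_closure_of_tendsto hprob (mem_of_superset hS (subset_preimage_image prob S))

lemma Icc_subset_closure_image_prob (hx : 0 ≤ x) (hy : 0 ≤ y) (h : Icc x y ⊆ limitRatios S) :
    Icc (1 + y)⁻¹ (1 + x)⁻¹ ⊆ closure (prob '' S) := by
  rintro p ⟨hyp, hpx⟩
  have hp : 0 < p := lt_of_lt_of_le (by positivity) hyp
  have hmem : p⁻¹ - 1 ∈ Icc x y :=
    ⟨by linarith [(le_inv_comm₀ hp (by positivity)).1 hpx],
      by linarith [(inv_le_comm₀ (by positivity) hp).1 hyp]⟩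
  simpa using inv_one_add_mem_closure_image_prob (h hmem)

end Density

end PointedTree

section Values

open PointedTree

lemma treeValues_eq_image_prob : treeValues = prob.{0} '' univ := by
  ext p
  constructor
  · rintro ⟨V, _, T, v, hT, rfl⟩
    exact ⟨⟨V, T, v, hT⟩, mem_univ _, rfl⟩
  · rintro ⟨T, -, rfl⟩
    exact ⟨T.carrier, T.finite, T.graph, T.root, T.isTree, rfl⟩

lemma leafValues_eq_image_prob :
    leafValues =
      prob.{0} '' {T | IsSeriesReduced T.graph ∧ 2 < T.order ∧ IsLeafOf T.graph T.root} := by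
  ext p
  constructor
  · rintro ⟨V, _, T, v, hT, hred, hcard, hv, rfl⟩
    exact ⟨⟨V, T, v, hT⟩, ⟨hred, hcard, hv⟩, rfl⟩
  · rintro ⟨T, ⟨hred, hcard, hv⟩, rfl⟩
    exact ⟨T.carrier, T.finite, T.graph, T.root, T.isTree, hred, hcard, hv, rfl⟩

lemma internalValues_eq_image_prob :
    internalValues =
      prob.{0} '' {T | IsSeriesReduced T.graph ∧ 2 < T.order ∧ ¬ IsLeafOf T.graph T.root} := by
  ext p
  constructor
  · rintro ⟨V, _, T, v, hT, hred, hcard, hv, rfl⟩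
    exact ⟨⟨V, T, v, hT⟩, ⟨hred, hcard, hv⟩, rfl⟩
  · rintro ⟨T, ⟨hred, hcard, hv⟩, rfl⟩
    exact ⟨T.carrier, T.finite, T.graph, T.root, T.isTree, hred, hcard, hv, rfl⟩

lemma treeValues_subset_Icc : treeValues ⊆ Icc 0 1 := by
  rw [treeValues_eq_image_prob]
  exact image_subset_iff.2 fun T _ ↦ T.prob_mem_Icc_zero_one

theorem closure_treeValues : closure treeValues = Icc 0 1 := by
  refine (closure_minimal treeValues_subset_Icc isClosed_Icc).antisymm ?_
  rw [← closure_Ioc (zero_ne_one' ℝ), treeValues_eq_image_prob]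
  refine closure_minimal (fun p hp ↦ ?_) isClosed_closure
  have hmem : p⁻¹ - 1 ∈ limitRatios.{0} univ :=
    limitRatios_univ.symm ▸ sub_nonneg.2 ((one_le_inv₀ hp.1).2 hp.2)
  simpa using inv_one_add_mem_closure_image_prob hmem

theorem closure_leafValues : closure leafValues = Icc (1 / 3) (1 / 2) := by
  rw [leafValues_eq_image_prob]
  refine Subset.antisymm (closure_minimal (image_subset_iff.2 ?_) isClosed_Icc) ?_
  · exact fun T hT ↦ prob_mem_Icc_of_isLeafOf_root hT.1 hT.2.1 hT.2.2
  · have hsub : {T : PointedTree.{0} | T.IsReducedOffRoot ∧ T.rootDegree = 1 ∧ 2 < T.order} ⊆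
        {T | IsSeriesReduced T.graph ∧ 2 < T.order ∧ IsLeafOf T.graph T.root} :=
      fun T ⟨hred, hd, horder⟩ ↦ ⟨isSeriesReduced_graph_iff.2 ⟨hred, by lia⟩, horder, hd⟩
    convert Icc_subset_closure_image_prob zero_le_one zero_le_two
      (Icc_one_two_subset_limitRatios.trans (limitRatios_mono hsub)) using 2 <;> norm_num

theorem closure_internalValues : closure internalValues = Icc (2 / 3) 1 := by
  rw [internalValues_eq_image_prob]
  refine Subset.antisymm (closure_minimal (image_subset_iff.2 ?_) isClosed_Icc) ?_
  · exact fun T hT ↦ prob_mem_Icc_of_not_isLeafOf_root hT.1 hT.2.1 hT.2.2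
  · have hsub : reducedTrees.{0} 3 ⊆
        {T | IsSeriesReduced T.graph ∧ 2 < T.order ∧ ¬ IsLeafOf T.graph T.root} := by
      rintro T ⟨hred, hd⟩
      have horder := T.rootDegree_lt_order
      exact ⟨isSeriesReduced_graph_iff.2 ⟨hred, by lia⟩, by lia,
        fun hleaf : T.rootDegree = 1 ↦ by lia⟩
    convert Icc_subset_closure_image_prob le_rfl (by positivity)
      (Icc_zero_half_subset_limitRatios_reducedTrees_three.trans (limitRatios_mono hsub)) using 2
      <;> norm_num

end Values

theorem mainTheorem5 :
    -- arbitrary trees: the values lie in [0,1] and are dense there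
    (treeValues ⊆ Set.Icc 0 1 ∧ closure treeValues = Set.Icc 0 1) ∧
    -- series-reduced trees with more than two vertices: the ranges
    (∀ (V : Type*) [Finite V] (T : SimpleGraph V), T.IsTree → IsSeriesReduced T →
      2 < Nat.card V → ∀ v : V,
        (IsLeafOf T v → subtreeProb T v ∈ Set.Icc (1 / 3 : ℝ) (1 / 2)) ∧
        (¬ IsLeafOf T v → subtreeProb T v ∈ Set.Icc (2 / 3 : ℝ) 1)) ∧
    -- the values are dense in the respective ranges
    closure leafValues = Set.Icc (1 / 3 : ℝ) (1 / 2) ∧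
    closure internalValues = Set.Icc (2 / 3 : ℝ) 1 := by
  refine ⟨⟨treeValues_subset_Icc, closure_treeValues⟩, fun V _ T hT hred hcard v ↦ ?_,
    closure_leafValues, closure_internalValues⟩
  let P : PointedTree := ⟨V, T, v, hT⟩
  exact ⟨PointedTree.prob_mem_Icc_of_isLeafOf_root (T := P) hred hcard,
    PointedTree.prob_mem_Icc_of_not_isLeafOf_root (T := P) hred hcard⟩
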